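/- Let $k$ be a perfect field of characteristic $p>0$, let $n\ge 0$ and let $R=k[x_1,\dots,x_n]$ be the polynomial ring. Identify each $f\in R$ with the multiplication operator $g\mapsto fg$ in $\operatorname{End}_k(R)$. Let $D_{R|k}=\bigcup_{m\ge 0}D^m_{R|k}\subseteq\operatorname{End}_k(R)$ be the ring of $k$-linear differential operators on $R$, where $D^0_{R|k}=R$ and, for $m\ge 1$, $D^m_{R|k}=\{\xi\in\operatorname{End}_k(R): \xi f-f\xi\in D^{m-1}_{R|k}\text{ for all }f\in R\}$. Then there is exactly one ring anti-automorphism $\Phi$ of $D_{R|k}$ that fixes $R$; that is, exactly one additive bijection $\Phi:D_{R|k}\to D_{R|k}$ such that $\Phi(1)=1$, $\Phi(\xi\eta)=\Phi(\eta)\Phi(\xi)$ for all $\xi,\eta\in D_{R|k}$, and $\Phi(f)=f$ for all $f\in R$. -/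

import Mathlib

namespace DiffOp

variable (k R : Type*) [CommRing k] [CommRing R] [Algebra k R]

/-- The operator `g ↦ f * g` on `R`, for `f` in `R`, as a `k`-linear endomorphism of `R`. -/
def mulOp (f : R) : Module.End k R := Algebra.lmul k R f

/-- `D^n_{R|k}`: the `k`-linear differential operators of order at most `n` on `R`.
Order at most `0` means multiplication by an element of `R`; an operator has order at most
`n + 1` when all its commutators with elements of `R` have order at most `n`. -/
def order : ℕ → Submodule k (Module.End k R)
  | 0 => LinearMap.range (Algebra.lmul k R).toLinearMap
  | n + 1 =>
    { carrier := {ξ | ∀ f : R, ξ * mulOp k R f - mulOp k R f * ξ ∈ order n}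
      add_mem' := by
        intro a b ha hb f
        have h := (order n).add_mem (ha f) (hb f)
        have e : (a + b) * mulOp k R f - mulOp k R f * (a + b) =
            (a * mulOp k R f - mulOp k R f * a) + (b * mulOp k R f - mulOp k R f * b) := by
          noncomm_ring
        rw [e]
        exact h
      zero_mem' := by
        intro f
        simp
      smul_mem' := by
        intro c a ha f
        have h := (order n).smul_mem c (ha f)
        rw [smul_sub] at h
        simpa only [smul_mul_assoc, mul_smul_comm] using h }

variable {k R}

theorem mem_order_zero {ξ : Module.End k R} : ξ ∈ order k R 0 ↔ ∃ f : R, mulOp k R f = ξ :=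
  Iff.rfl

theorem mem_order_succ {n : ℕ} {ξ : Module.End k R} :
    ξ ∈ order k R (n + 1) ↔ ∀ f : R, ξ * mulOp k R f - mulOp k R f * ξ ∈ order k R n :=
  Iff.rfl

theorem mulOp_comm (f g : R) : mulOp k R f * mulOp k R g = mulOp k R g * mulOp k R f := by
  simp only [mulOp, ← map_mul, mul_comm]

theorem mulOp_mem_order_zero (f : R) : mulOp k R f ∈ order k R 0 := ⟨f, rfl⟩

theorem order_le_succ (n : ℕ) : order k R n ≤ order k R (n + 1) := by
  induction n with
  | zero =>
    rintro _ ⟨g, rfl⟩ f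
    have h : mulOp k R g * mulOp k R f - mulOp k R f * mulOp k R g = 0 := by
      rw [mulOp_comm, sub_self]
    exact h ▸ (order k R 0).zero_mem
  | succ n ih => exact fun ξ hξ f => ih (hξ f)

theorem order_mono : Monotone (order k R) := monotone_nat_of_le_succ order_le_succ

theorem mulOp_mul_mem (g : R) (n : ℕ) :
    ∀ ξ ∈ order k R n, mulOp k R g * ξ ∈ order k R n := by
  induction n with
  | zero =>
    rintro _ ⟨f, rfl⟩
    exact ⟨g * f, map_mul (Algebra.lmul k R) g f⟩
  | succ n ih =>
    intro ξ hξ f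
    have e : mulOp k R g * ξ * mulOp k R f - mulOp k R f * (mulOp k R g * ξ) =
        mulOp k R g * (ξ * mulOp k R f - mulOp k R f * ξ) := by
      rw [← mul_assoc (mulOp k R f), mulOp_comm f g]
      simp only [mul_sub, mul_assoc]
    rw [e]
    exact ih _ (hξ f)

theorem mul_mulOp_mem (g : R) (n : ℕ) :
    ∀ ξ ∈ order k R n, ξ * mulOp k R g ∈ order k R n := by
  induction n with
  | zero =>
    rintro _ ⟨f, rfl⟩
    exact ⟨f * g, map_mul (Algebra.lmul k R) f g⟩
  | succ n ih =>
    intro ξ hξ f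
    have e : ξ * mulOp k R g * mulOp k R f - mulOp k R f * (ξ * mulOp k R g) =
        (ξ * mulOp k R f - mulOp k R f * ξ) * mulOp k R g := by
      rw [mul_assoc ξ, mulOp_comm g f]
      simp only [sub_mul, mul_assoc]
    rw [e]
    exact ih _ (hξ f)

theorem mul_mem_order (N : ℕ) : ∀ n m : ℕ, n + m = N → ∀ ξ ∈ order k R n, ∀ η ∈ order k R m,
    ξ * η ∈ order k R N := by
  induction N with
  | zero =>
    intro n m h ξ hξ η hη
    obtain rfl : n = 0 := by omega
    obtain rfl : m = 0 := by omega
    obtain ⟨f, rfl⟩ := hξ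
    exact mulOp_mul_mem f 0 η hη
  | succ N ih =>
    intro n m h ξ hξ η hη
    rcases n with _ | n
    · obtain ⟨f, rfl⟩ := hξ
      obtain rfl : m = N + 1 := by omega
      exact mulOp_mul_mem f _ η hη
    rcases m with _ | m
    · obtain ⟨f, rfl⟩ := hη
      obtain rfl : n = N := by omega
      exact mul_mulOp_mem f _ ξ hξ
    intro f
    have e : ξ * η * mulOp k R f - mulOp k R f * (ξ * η) =
        ξ * (η * mulOp k R f - mulOp k R f * η) +
          (ξ * mulOp k R f - mulOp k R f * ξ) * η := by
      simp only [mul_sub, sub_mul, mul_assoc]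
      abel
    rw [e]
    exact (order k R N).add_mem (ih (n + 1) m (by omega) _ hξ _ (hη f))
      (ih n (m + 1) (by omega) _ (hξ f) _ hη)

variable (k R)

/-- `D_{R|k}`: the ring of `k`-linear differential operators on `R`, the union of the
`D^n_{R|k}`, as a `k`-subalgebra of `End_k(R)`. -/
def ring : Subalgebra k (Module.End k R) where
  carrier := {ξ | ∃ n : ℕ, ξ ∈ order k R n}
  mul_mem' := by
    rintro a b ⟨n, ha⟩ ⟨m, hb⟩
    exact ⟨n + m, mul_mem_order _ n m rfl a ha b hb⟩
  add_mem' := by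
    rintro a b ⟨n, ha⟩ ⟨m, hb⟩
    exact ⟨max n m, (order k R _).add_mem (order_mono (le_max_left n m) ha)
      (order_mono (le_max_right n m) hb)⟩
  algebraMap_mem' := by
    intro c
    exact ⟨0, algebraMap k R c, (Algebra.lmul k R).commutes c⟩

/-- The element of `D_{R|k}` given by multiplication by `f`, through which `R` is regarded as a
subring of `D_{R|k}`. -/
def ofRing (f : R) : ring k R := ⟨mulOp k R f, 0, mulOp_mem_order_zero f⟩

/-- A ring anti-automorphism `Φ` of `D_{R|k}`, that is, a ring isomorphism from `D_{R|k}` to its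
opposite ring, fixes `R` if `Φ f = f` for all `f` in `R`. -/
def FixesBase (Φ : ring k R ≃+* (ring k R)ᵐᵒᵖ) : Prop :=
  ∀ f : R, Φ (ofRing k R f) = MulOpposite.op (ofRing k R f)

end DiffOp

/-!
Write `R = k[x_1, …, x_n]` and `∂^[α]` for the divided power `∂^α / α!`, an operator on `R` that is
defined in every characteristic (`hasse`). Two facts about divided powers carry the proof: the
commutator of `∂^[α]` with `x_i` is `∂^[α - e_i]`, or `0` if `α_i = 0`
(`hasse_add_single_commutator`, `hasse_commutator_of_eq_zero`), and the divided powers generate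
`D_{R|k}` as a left `R`-module (`eq_hasse_sum`). The latter holds because an operator of order at
most `m` is determined by its values on monomials of degree at most `m`, and these values can be
matched by an `R`-combination of divided powers.

*Existence.* For `q = p ^ e`, the form that sends `(f, g)` to the coefficient of
`(x_1 ⋯ x_n) ^ (q - 1)` in `f g` is symmetric, every `f` in `R` is self-adjoint for it, and for
`α_i < q` the adjoint of `∂^[α]` is `(-1) ^ |α| ∂^[α]`. The last statement amounts to the
congruence `(b choose a) ≡ (-1) ^ a (q - 1 + a - b choose a)` modulo `p`. Since the forms for large
`e` together determine a polynomial, every differential operator has a unique adjoint for all of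
the forms with `e` large, and taking adjoints is an anti-automorphism that fixes `R`
(`adjointEquiv`).

*Uniqueness.* Two such anti-automorphisms differ by an automorphism `τ` of `D_{R|k}` that fixes
`R`, and it suffices that `τ` fixes each `∂^[α]` (`apply_hasseRing`). By induction on `|α|` it fixes
the commutators of `∂^[α]` with the variables, so that `τ(∂^[α]) = ∂^[α] + f` with `f` in `R`. In
characteristic `p`, with `α ≠ 0` and `q` large, `∂^[α] ∂^[(q-1, …, q-1)] = 0`. Hence every `w` in the
image of `τ(∂^[(q-1, …, q-1)])` satisfies `∂^[α] w + f w = 0`. Such a `w` can be chosen nonzero;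
since `∂^[α]` lowers degrees, `f = 0`.
-/

namespace DiffOp

open MvPolynomial

variable {σ k : Type*} [CommRing k]

/-! ### Differential operators of bounded order on a polynomial ring -/

theorem end_ext {ξ η : Module.End k (MvPolynomial σ k)}
    (h : ∀ β, ξ (monomial β 1) = η (monomial β 1)) : ξ = η :=
  (basisMonomials σ k).ext fun β => by simpa using h β

theorem mulOp_apply (f g : MvPolynomial σ k) : mulOp k _ f g = f * g := rfl

theorem X_mul_monomial (i : σ) (β : σ →₀ ℕ) (c : k) :
    X i * monomial β c = monomial (β + Finsupp.single i 1) c := by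
  rw [X, monomial_mul, one_mul, add_comm]

theorem exists_eq_add_single {α : σ →₀ ℕ} {i : σ} (hi : α i ≠ 0) :
    ∃ α', α = α' + Finsupp.single i 1 :=
  ⟨α - Finsupp.single i 1, (tsub_add_cancel_of_le
    (Finsupp.single_le_iff.2 (Nat.one_le_iff_ne_zero.2 hi))).symm⟩

/-- It suffices to test the condition defining the order on the variables. -/
theorem mem_order_succ_of_X {ξ : Module.End k (MvPolynomial σ k)} {m : ℕ}
    (h : ∀ i, ξ * mulOp k _ (X i) - mulOp k _ (X i) * ξ ∈ order k _ m) :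
    ξ ∈ order k (MvPolynomial σ k) (m + 1) := by
  intro f
  induction f using MvPolynomial.induction_on with
  | C c =>
    have e : ξ * mulOp k _ (C c) - mulOp k _ (C c) * ξ = 0 := by
      refine LinearMap.ext fun g => ?_
      simp [mulOp_apply, C_mul']
    rw [e]
    exact zero_mem _
  | add f g hf hg =>
    have e : ξ * mulOp k _ (f + g) - mulOp k _ (f + g) * ξ =
        (ξ * mulOp k _ f - mulOp k _ f * ξ) + (ξ * mulOp k _ g - mulOp k _ g * ξ) := by
      simp only [mulOp, map_add, mul_add, add_mul]
      abel
    rw [e]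
    exact add_mem hf hg
  | mul_X f i hf =>
    have e : ξ * mulOp k _ (f * X i) - mulOp k _ (f * X i) * ξ =
        (ξ * mulOp k _ f - mulOp k _ f * ξ) * mulOp k _ (X i) +
          mulOp k _ f * (ξ * mulOp k _ (X i) - mulOp k _ (X i) * ξ) := by
      simp only [mulOp, map_mul, mul_sub, sub_mul, mul_assoc]
      abel
    rw [e]
    exact add_mem (mul_mulOp_mem _ _ _ hf) (mulOp_mul_mem _ _ _ (h i))

theorem eq_mulOp_of_commute_X {ξ : Module.End k (MvPolynomial σ k)}
    (h : ∀ i, ξ * mulOp k _ (X i) = mulOp k _ (X i) * ξ) : ξ = mulOp k _ (ξ 1) := by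
  refine LinearMap.ext fun f => ?_
  rw [mulOp_apply]
  induction f using MvPolynomial.induction_on with
  | C c => rw [← mul_one (C c), C_mul', map_smul, mul_smul_comm, mul_one]
  | add f g hf hg => rw [map_add, hf, hg, mul_add]
  | mul_X f i hf =>
    have := LinearMap.congr_fun (h i) f
    simp only [Module.End.mul_apply, mulOp_apply] at this
    rw [mul_comm f, this, hf]
    ring

/-- A differential operator of order at most `m` is determined by its values on the monomials of
degree at most `m`. -/
theorem eq_zero_of_monomials (m : ℕ) : ∀ ξ ∈ order k (MvPolynomial σ k) m,
    (∀ β : σ →₀ ℕ, Finsupp.degree β ≤ m → ξ (monomial β 1) = 0) → ξ = 0 := by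
  induction m with
  | zero =>
    rintro _ ⟨f, rfl⟩ h
    have h1 : f * 1 = 0 := h 0 (by simp)
    rw [mul_one] at h1
    simp [h1]
  | succ m ih =>
    intro ξ hξ h
    have h1 : ξ 1 = 0 := h 0 (by simp)
    rw [eq_mulOp_of_commute_X (ξ := ξ) fun i => sub_eq_zero.1 (ih _ (hξ (X i)) fun β hβ => ?_), h1]
    · simp [mulOp]
    · simp only [LinearMap.sub_apply, Module.End.mul_apply, mulOp_apply, X_mul_monomial]
      rw [h _ (by simpa using hβ), h _ (by omega), mul_zero, sub_zero]

/-! ### Divided powers -/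

variable [Fintype σ]

/-- The binomial coefficient `∏ i, (β i).choose (α i)` of two multi-indices. It vanishes unless
`α ≤ β`. -/
def multiChoose (β α : σ →₀ ℕ) : ℕ := ∏ i, (β i).choose (α i)

theorem multiChoose_eq_zero {β α : σ →₀ ℕ} (h : ¬ α ≤ β) : multiChoose β α = 0 := by
  rw [Finsupp.le_def] at h
  push Not at h
  obtain ⟨i, hi⟩ := h
  exact Finset.prod_eq_zero (Finset.mem_univ i) (Nat.choose_eq_zero_of_lt hi)

theorem multiChoose_self (α : σ →₀ ℕ) : multiChoose α α = 1 := by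
  simp [multiChoose]

theorem multiChoose_zero (β : σ →₀ ℕ) : multiChoose β 0 = 1 := by
  simp [multiChoose]

theorem multiChoose_add_single (β α : σ →₀ ℕ) (i : σ) :
    multiChoose (β + Finsupp.single i 1) (α + Finsupp.single i 1) =
      multiChoose β α + multiChoose β (α + Finsupp.single i 1) := by
  classical
  have h : ∀ j ∈ Finset.univ.erase i, (Finsupp.single i 1 : σ →₀ ℕ) j = 0 := fun j hj =>
    Finsupp.single_eq_of_ne (Finset.ne_of_mem_erase hj)
  have split : ∀ u v : σ →₀ ℕ, multiChoose u v =
      (u i).choose (v i) * ∏ j ∈ Finset.univ.erase i, (u j).choose (v j) := fun u v =>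
    (Finset.mul_prod_erase _ _ (Finset.mem_univ i)).symm
  simp only [split]
  have e1 : ∏ j ∈ Finset.univ.erase i,
      ((β + Finsupp.single i 1 : σ →₀ ℕ) j).choose ((α + Finsupp.single i 1 : σ →₀ ℕ) j) =
      ∏ j ∈ Finset.univ.erase i, (β j).choose (α j) :=
    Finset.prod_congr rfl fun j hj => by simp [h j hj]
  have e2 : ∏ j ∈ Finset.univ.erase i, (β j).choose ((α + Finsupp.single i 1 : σ →₀ ℕ) j) =
      ∏ j ∈ Finset.univ.erase i, (β j).choose (α j) :=
    Finset.prod_congr rfl fun j hj => by simp [h j hj]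
  rw [e1, e2, ← add_mul]
  simp [Nat.choose_succ_succ]

theorem multiChoose_add_single_left (β α : σ →₀ ℕ) {i : σ} (hi : α i = 0) :
    multiChoose (β + Finsupp.single i 1) α = multiChoose β α := by
  refine Finset.prod_congr rfl fun j _ => ?_
  by_cases h : j = i
  · subst h
    simp [hi]
  · simp [Finsupp.single_eq_of_ne h]

/-- The divided power operator `∂^α / α!` on polynomials, which sends `x^β` to
`(β choose α) x^(β - α)`; it is defined over every commutative ring. The truncated subtraction is
harmless, since the binomial coefficient vanishes unless `α ≤ β`. -/
noncomputable def hasse (α : σ →₀ ℕ) : Module.End k (MvPolynomial σ k) :=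
  (basisMonomials σ k).constr k fun β => monomial (β - α) (multiChoose β α : k)

theorem hasse_monomial (α β : σ →₀ ℕ) (c : k) :
    hasse α (monomial β c) = monomial (β - α) (c * multiChoose β α) := by
  have h : (monomial β c : MvPolynomial σ k) = c • basisMonomials σ k β := by
    simp [smul_monomial]
  rw [h, map_smul, hasse, Module.Basis.constr_basis, smul_monomial, smul_eq_mul]

theorem coeff_hasse (α γ : σ →₀ ℕ) (f : MvPolynomial σ k) :
    coeff γ (hasse α f) = multiChoose (γ + α) α * coeff (γ + α) f := by
  classical
  induction f using MvPolynomial.induction_on' with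
  | monomial β c =>
    rw [hasse_monomial, coeff_monomial, coeff_monomial]
    by_cases hle : α ≤ β
    · by_cases h : β = γ + α
      · subst h
        simp [mul_comm]
      · rw [if_neg h, if_neg, mul_zero]
        rintro rfl
        exact h (tsub_add_cancel_of_le hle).symm
    · rw [multiChoose_eq_zero hle, if_neg (c := β = γ + α)]
      · simp
      · rintro rfl
        exact hle le_add_self
  | add f g hf hg => rw [map_add, coeff_add, coeff_add, hf, hg, mul_add]

theorem hasse_zero : hasse 0 = (1 : Module.End k (MvPolynomial σ k)) :=
  end_ext fun β => by simp [hasse_monomial, multiChoose_zero]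

theorem hasse_add_single_commutator (α : σ →₀ ℕ) (i : σ) :
    hasse (α + Finsupp.single i 1) * mulOp k _ (X i) -
      mulOp k _ (X i) * hasse (α + Finsupp.single i 1) = hasse (k := k) α := by
  refine end_ext fun β => ?_
  simp only [LinearMap.sub_apply, Module.End.mul_apply, mulOp_apply, X_mul_monomial,
    hasse_monomial, one_mul, multiChoose_add_single, add_tsub_add_eq_tsub_right]
  by_cases h : α + Finsupp.single i 1 ≤ β
  · have e : β - (α + Finsupp.single i 1) + Finsupp.single i 1 = β - α := by
      rw [← tsub_tsub, tsub_add_cancel_of_le]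
      exact le_tsub_of_add_le_left h
    rw [e, ← map_sub]
    simp
  · simp [multiChoose_eq_zero h]

theorem hasse_commutator_of_eq_zero {α : σ →₀ ℕ} {i : σ} (hi : α i = 0) :
    hasse α * mulOp k _ (X i) - mulOp k _ (X i) * hasse α = 0 := by
  refine end_ext fun β => ?_
  simp only [LinearMap.sub_apply, Module.End.mul_apply, mulOp_apply, X_mul_monomial,
    hasse_monomial, one_mul, multiChoose_add_single_left β α hi, LinearMap.zero_apply]
  by_cases h : α ≤ β
  · rw [tsub_add_eq_add_tsub h, sub_self]
  · simp [multiChoose_eq_zero h]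

theorem hasse_mem_order (m : ℕ) : ∀ α : σ →₀ ℕ, Finsupp.degree α = m →
    hasse α ∈ order k (MvPolynomial σ k) m := by
  induction m with
  | zero =>
    intro α hα
    rw [(Finsupp.degree_eq_zero_iff α).1 hα, hasse_zero]
    exact ⟨1, map_one (Algebra.lmul k _)⟩
  | succ m ih =>
    refine fun α hα => mem_order_succ_of_X fun i => ?_
    by_cases hi : α i = 0
    · rw [hasse_commutator_of_eq_zero hi]
      exact zero_mem _
    · obtain ⟨α, rfl⟩ := exists_eq_add_single hi
      rw [hasse_add_single_commutator]
      refine ih α ?_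
      simpa using hα

theorem hasse_mem_ring (α : σ →₀ ℕ) : hasse α ∈ ring k (MvPolynomial σ k) :=
  ⟨_, hasse_mem_order _ α rfl⟩

/-- Every operator agrees on the monomials of degree less than `m` with an `R`-linear combination
of divided powers. -/
theorem exists_hasse_sum (ξ : Module.End k (MvPolynomial σ k)) (m : ℕ) :
    ∃ (s : Finset (σ →₀ ℕ)) (c : (σ →₀ ℕ) → MvPolynomial σ k),
      (∀ α ∈ s, Finsupp.degree α < m) ∧ ∀ β : σ →₀ ℕ, Finsupp.degree β < m →
        ξ (monomial β 1) =
          (∑ α ∈ s, mulOp k _ (c α) * hasse α : Module.End k (MvPolynomial σ k)) (monomial β 1) := by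
  classical
  induction m with
  | zero => exact ⟨∅, 0, by simp, by simp⟩
  | succ m ih =>
    obtain ⟨s, c, hs, h⟩ := ih
    obtain ⟨η, hη⟩ : ∃ η : Module.End k (MvPolynomial σ k),
      η = ∑ α ∈ s, mulOp k _ (c α) * hasse α := ⟨_, rfl⟩
    rw [← hη] at h
    let t : Finset (σ →₀ ℕ) :=
      (Finsupp.finite_of_degree_le (σ := σ) m).toFinset.filter fun α => Finsupp.degree α = m
    have ht : ∀ α, α ∈ t ↔ Finsupp.degree α = m := fun α => by
      simp only [t, Finset.mem_filter, Set.Finite.mem_toFinset, Set.mem_ofPred_eq]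
      omega
    have hd : Disjoint s t := Finset.disjoint_left.2 fun α h1 h2 =>
      (hs α h1).ne ((ht α).1 h2)
    refine ⟨s ∪ t, fun α => if α ∈ s then c α else (ξ - η) (monomial α 1), ?_, ?_⟩
    · intro α hα
      rcases Finset.mem_union.1 hα with hα | hα
      · exact (hs α hα).trans (Nat.lt_succ_self m)
      · exact ((ht α).1 hα).trans_lt (Nat.lt_succ_self m)
    intro β hβ
    -- A divided power of degree `m` kills every other monomial of degree at most `m`.
    have key : ∀ α ∈ t, α ≠ β → hasse α (monomial β (1 : k)) = 0 := by
      intro α hα hne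
      rw [hasse_monomial, multiChoose_eq_zero, Nat.cast_zero, mul_zero, map_zero]
      intro hle
      obtain ⟨γ, rfl⟩ := exists_add_of_le hle
      rw [map_add, (ht α).1 hα] at hβ
      have : γ = 0 := (Finsupp.degree_eq_zero_iff γ).1 (by omega)
      exact hne (by rw [this, add_zero])
    have e1 : ∑ α ∈ s, mulOp k _ (if α ∈ s then c α else (ξ - η) (monomial α 1)) * hasse α = η :=
      hη ▸ Finset.sum_congr rfl fun α hα => by rw [if_pos hα]
    rw [Finset.sum_union hd, e1, LinearMap.add_apply, LinearMap.sum_apply]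
    beta_reduce
    rcases (Nat.lt_succ_iff.1 hβ).lt_or_eq with hlt | heq
    · rw [Finset.sum_eq_zero, add_zero, h β hlt]
      intro α hα
      rw [Module.End.mul_apply, key α hα, map_zero]
      rintro rfl
      exact hlt.ne ((ht _).1 hα)
    · have hβt := (ht β).2 heq
      rw [Finset.sum_eq_single_of_mem β hβt]
      · rw [if_neg (Finset.disjoint_right.1 hd hβt), Module.End.mul_apply, hasse_monomial,
          multiChoose_self, mulOp_apply, tsub_self]
        have : (monomial (0 : σ →₀ ℕ) ((1 : k) * (1 : ℕ))) = (1 : MvPolynomial σ k) := by simp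
        rw [this, mul_one, LinearMap.sub_apply, add_sub_cancel]
      · intro α hα hne
        rw [Module.End.mul_apply, key α hα hne, map_zero]

/-- The divided powers generate the ring of differential operators as a left module over the
polynomial ring. -/
theorem eq_hasse_sum {ξ : Module.End k (MvPolynomial σ k)} (hξ : ξ ∈ ring k (MvPolynomial σ k)) :
    ∃ (s : Finset (σ →₀ ℕ)) (c : (σ →₀ ℕ) → MvPolynomial σ k),
      ξ = ∑ α ∈ s, mulOp k _ (c α) * hasse α := by
  obtain ⟨m, hm⟩ := hξ
  obtain ⟨s, c, hs, h⟩ := exists_hasse_sum ξ (m + 1)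
  refine ⟨s, c, sub_eq_zero.1 (eq_zero_of_monomials m _ ?_ fun β hβ => ?_)⟩
  · exact sub_mem hm (sum_mem fun α hα => mulOp_mul_mem _ _ _
      (order_mono (Nat.lt_succ_iff.1 (hs α hα)) (hasse_mem_order _ α rfl)))
  · rw [LinearMap.sub_apply, h β (Nat.lt_succ_iff.2 hβ), sub_self]

/-- Divided powers lower degrees. -/
theorem totalDegree_hasse_add_le {α : σ →₀ ℕ} {f : MvPolynomial σ k} (h : hasse α f ≠ 0) :
    (hasse α f).totalDegree + Finsupp.degree α ≤ f.totalDegree := by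
  obtain ⟨γ, hγ, e⟩ := Finset.exists_mem_eq_sup (hasse α f).support (support_nonempty.2 h)
    (fun s => s.sum fun _ e => e)
  have hγ' : γ + α ∈ f.support := by
    rw [mem_support_iff, coeff_hasse] at hγ
    exact mem_support_iff.2 (right_ne_zero_of_mul hγ)
  calc (hasse α f).totalDegree + Finsupp.degree α = Finsupp.degree (γ + α) := by
        rw [map_add]
        exact congrArg (· + _) e
    _ ≤ f.totalDegree := le_totalDegree hγ'

end DiffOp

namespace DiffOp

open MvPolynomial Filter

/-! ### Binomial coefficients modulo `p` -/

theorem dvd_choose_add_pow_sub_one {p : ℕ} (hp : p.Prime) {a e : ℕ} (ha : 0 < a)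
    (hae : a < p ^ e) : p ∣ (a + (p ^ e - 1)).choose a := by
  obtain ⟨b, rfl⟩ := Nat.exists_eq_succ_of_ne_zero ha.ne'
  have h1 := Nat.choose_succ_right_eq (b.succ + (p ^ e - 1)) b
  rw [show b.succ + (p ^ e - 1) - b = p ^ e by omega] at h1
  by_contra h
  have h2 : p ^ e ∣ b + 1 := ((hp.coprime_iff_not_dvd.2 h).pow_left e).dvd_of_dvd_mul_left
    ⟨_, h1.trans (mul_comm _ _)⟩
  exact absurd (Nat.le_of_dvd ha h2) (by omega)

/-- The congruence `(b choose a) ≡ (-1) ^ a ((p ^ e - 1 + a - b) choose a)` modulo `p`.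
The right-hand side is `(b - p ^ e) choose a`, so this says that `b choose a` depends only on the
residue of `b` modulo `p ^ e`; the proof is a double induction by Pascal's rule. -/
theorem cast_choose_reflect {p : ℕ} (hp : p.Prime) (k : Type*) [CommRing k] [CharP k p] {e : ℕ} :
    ∀ {a : ℕ}, a < p ^ e → ∀ {b c : ℕ}, b + c + 1 = p ^ e + a →
      (b.choose a : k) = (-1) ^ a * c.choose a := by
  intro a
  induction a with
  | zero => simp
  | succ a iha =>
    intro ha b
    induction b with
    | zero =>
      intro c hc
      have : ((c.choose (a + 1) : ℕ) : k) = 0 := by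
        rw [CharP.cast_eq_zero_iff k p, show c = a + 1 + (p ^ e - 1) by omega]
        exact dvd_choose_add_pow_sub_one hp a.succ_pos ha
      simp [this]
    | succ b ihb =>
      intro c hc
      have h1 := iha (Nat.lt_of_succ_lt ha) (b := b) (c := c) (by omega)
      have h2 := ihb (c := c + 1) (by omega)
      rw [Nat.choose_succ_succ] at h2 ⊢
      push_cast at h2 ⊢
      rw [h1, h2, Nat.succ_eq_add_one]
      ring

variable {σ k : Type*} [Fintype σ] [CommRing k]

/-- The exponent `(p ^ e - 1, …, p ^ e - 1)`. -/
noncomputable def corner (σ : Type*) [Fintype σ] (p e : ℕ) : σ →₀ ℕ :=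
  Finsupp.equivFunOnFinite.symm fun _ => p ^ e - 1

@[simp]
theorem corner_apply (p e : ℕ) (i : σ) : corner σ p e i = p ^ e - 1 := rfl

theorem eventually_le_corner {p : ℕ} (hp : p.Prime) (α : σ →₀ ℕ) :
    ∀ᶠ e in atTop, α ≤ corner σ p e := by
  simp only [Finsupp.le_def, eventually_all]
  intro i
  filter_upwards [eventually_ge_atTop (α i)] with e he
  have := Nat.lt_pow_self hp.one_lt (n := e)
  rw [corner_apply]
  omega

theorem lt_pow_of_le_corner {p e : ℕ} (hp : p.Prime) {α : σ →₀ ℕ} (h : α ≤ corner σ p e) (i : σ) :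
    α i < p ^ e := by
  have h1 := h i
  have h2 := pow_pos hp.pos e
  rw [corner_apply] at h1
  omega

theorem cast_multiChoose_reflect {p : ℕ} (hp : p.Prime) [CharP k p] {e : ℕ} {α β γ : σ →₀ ℕ}
    (hα : α ≤ corner σ p e) (h : β + γ = corner σ p e + α) :
    (multiChoose β α : k) = (-1) ^ Finsupp.degree α * multiChoose γ α := by
  rw [multiChoose, multiChoose, Nat.cast_prod, Nat.cast_prod, Finsupp.degree_eq_sum,
    ← Finset.prod_pow_eq_pow_sum, ← Finset.prod_mul_distrib]
  refine Finset.prod_congr rfl fun i _ => ?_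
  have h1 := lt_pow_of_le_corner hp hα i
  have h2 := DFunLike.congr_fun h i
  simp only [Finsupp.add_apply, corner_apply] at h2
  exact cast_choose_reflect hp k h1 (by omega)

/-! ### Adjoint operators -/

/-- Operators `ξ` and `η` on a polynomial ring are adjoint if, for all large `e`, they are adjoint
with respect to the symmetric bilinear form that sends `(f, g)` to the coefficient of
`(x_1 ⋯ x_n) ^ (p ^ e - 1)` in `f * g`. -/
def IsAdjoint (p : ℕ) (ξ η : Module.End k (MvPolynomial σ k)) : Prop :=
  ∀ᶠ e in atTop, ∀ f g : MvPolynomial σ k,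
    coeff (corner σ p e) (ξ f * g) = coeff (corner σ p e) (f * η g)

namespace IsAdjoint

variable {p : ℕ} {ξ ξ' η η' : Module.End k (MvPolynomial σ k)}

theorem symm (h : IsAdjoint p ξ η) : IsAdjoint p η ξ := by
  filter_upwards [h] with e he f g
  rw [mul_comm, ← he, mul_comm]

theorem mul (h : IsAdjoint p ξ η) (h' : IsAdjoint p ξ' η') : IsAdjoint p (ξ * ξ') (η' * η) := by
  filter_upwards [h, h'] with e he he' f g
  rw [Module.End.mul_apply, he, he', Module.End.mul_apply]

theorem add (h : IsAdjoint p ξ η) (h' : IsAdjoint p ξ' η') : IsAdjoint p (ξ + ξ') (η + η') := by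
  filter_upwards [h, h'] with e he he' f g
  rw [LinearMap.add_apply, LinearMap.add_apply, add_mul, mul_add, coeff_add, coeff_add, he, he']

theorem zero : IsAdjoint p (0 : Module.End k (MvPolynomial σ k)) 0 :=
  Eventually.of_forall fun e f g => by simp

theorem sum {ι : Type*} (s : Finset ι) {ξ η : ι → Module.End k (MvPolynomial σ k)}
    (h : ∀ i ∈ s, IsAdjoint p (ξ i) (η i)) : IsAdjoint p (∑ i ∈ s, ξ i) (∑ i ∈ s, η i) := by
  classical
  induction s using Finset.induction_on with
  | empty => exact zero
  | insert i s hi ih =>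
    rw [Finset.sum_insert hi, Finset.sum_insert hi]
    exact (h i (Finset.mem_insert_self i s)).add
      (ih fun j hj => h j (Finset.mem_insert_of_mem hj))

theorem mulOp (f : MvPolynomial σ k) : IsAdjoint p (mulOp k _ f) (mulOp k _ f) :=
  Eventually.of_forall fun e g h => by
    rw [mulOp_apply, mulOp_apply, mul_comm f, mul_assoc]

/-- Adjoints are unique, because the coefficient of `x^β` in a polynomial `h` is also that of the
exponent `(p ^ e - 1, …, p ^ e - 1)` in a monomial multiple of `h`. -/
theorem unique (hp : p.Prime) (h : IsAdjoint p ξ η) (h' : IsAdjoint p ξ η') : η = η' := by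
  refine LinearMap.ext fun g => MvPolynomial.ext _ _ fun β => ?_
  obtain ⟨e, he, he', hβ⟩ := (h.and (h'.and (eventually_le_corner hp β))).exists
  have key := (he (monomial (corner σ p e - β) 1) g).symm.trans (he' _ g)
  have hc : corner σ p e = corner σ p e - β + β := (tsub_add_cancel_of_le hβ).symm
  generalize corner σ p e - β = δ at hc key
  rw [hc, coeff_monomial_mul, coeff_monomial_mul, one_mul, one_mul] at key
  exact key

theorem of_monomials (h : ∀ᶠ e in atTop, ∀ β γ : σ →₀ ℕ,
    coeff (corner σ p e) (ξ (monomial β 1) * monomial γ 1) =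
      coeff (corner σ p e) (monomial β 1 * η (monomial γ 1))) : IsAdjoint p ξ η := by
  filter_upwards [h] with e he f g
  have key : ((LinearMap.mul k (MvPolynomial σ k)).compl₁₂ ξ LinearMap.id).compr₂
      (lcoeff k (corner σ p e)) =
      ((LinearMap.mul k (MvPolynomial σ k)).compl₁₂ LinearMap.id η).compr₂
        (lcoeff k (corner σ p e)) :=
    (basisMonomials σ k).ext fun β => (basisMonomials σ k).ext fun γ => by
      simpa using he β γ
  exact LinearMap.congr_fun₂ key f g

theorem hasse (hp : p.Prime) [CharP k p] (α : σ →₀ ℕ) :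
    IsAdjoint p (hasse (k := k) α) (((-1) ^ Finsupp.degree α : k) • DiffOp.hasse α) := by
  classical
  apply of_monomials
  filter_upwards [eventually_le_corner hp α] with e he β γ
  have key : ∀ β γ : σ →₀ ℕ, coeff (corner σ p e) (DiffOp.hasse α (monomial β (1 : k)) *
      monomial γ 1) = if β + γ = corner σ p e + α then (multiChoose β α : k) else 0 := by
    intro β γ
    rw [hasse_monomial, monomial_mul, coeff_monomial, one_mul, mul_one]
    by_cases hle : α ≤ β
    · refine if_congr ?_ rfl rfl
      rw [← add_left_inj α, tsub_add_eq_add_tsub hle,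
        tsub_add_cancel_of_le (hle.trans le_self_add)]
    · rw [multiChoose_eq_zero hle, Nat.cast_zero, ite_self, ite_self]
  rw [LinearMap.smul_apply, mul_smul_comm, coeff_smul, mul_comm (monomial β 1), key, key,
    add_comm γ]
  split_ifs with h
  · rw [cast_multiChoose_reflect hp he h, smul_eq_mul]
  · rw [smul_zero]

theorem exists_mem_ring (hp : p.Prime) [CharP k p] (hξ : ξ ∈ ring k (MvPolynomial σ k)) :
    ∃ η ∈ ring k (MvPolynomial σ k), IsAdjoint p ξ η := by
  obtain ⟨s, c, rfl⟩ := eq_hasse_sum hξ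
  refine ⟨_, ?_, sum s fun α _ => (mulOp (c α)).mul (hasse hp α)⟩
  exact sum_mem fun α _ => mul_mem
    (Subalgebra.smul_mem _ (hasse_mem_ring α) _) (ofRing k _ (c α)).2

end IsAdjoint

/-- The adjoint of a differential operator. -/
noncomputable def adjoint {p : ℕ} (hp : p.Prime) [CharP k p] (ξ : ring k (MvPolynomial σ k)) :
    ring k (MvPolynomial σ k) :=
  ⟨_, (IsAdjoint.exists_mem_ring hp ξ.2).choose_spec.1⟩

section

variable {p : ℕ} (hp : p.Prime) [CharP k p]

theorem isAdjoint_adjoint (ξ : ring k (MvPolynomial σ k)) :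
    IsAdjoint p (ξ : Module.End k (MvPolynomial σ k)) (adjoint hp ξ) :=
  (IsAdjoint.exists_mem_ring hp ξ.2).choose_spec.2

theorem adjoint_eq {ξ η : ring k (MvPolynomial σ k)}
    (h : IsAdjoint p (ξ : Module.End k (MvPolynomial σ k)) η) : adjoint hp ξ = η :=
  Subtype.ext ((isAdjoint_adjoint hp ξ).unique hp h)

theorem adjoint_adjoint (ξ : ring k (MvPolynomial σ k)) : adjoint hp (adjoint hp ξ) = ξ :=
  adjoint_eq hp (isAdjoint_adjoint hp ξ).symm

/-- Taking adjoints, as an anti-automorphism of the ring of differential operators. -/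
noncomputable def adjointEquiv :
    ring k (MvPolynomial σ k) ≃+* (ring k (MvPolynomial σ k))ᵐᵒᵖ where
  toFun ξ := .op (adjoint hp ξ)
  invFun ξ := adjoint hp ξ.unop
  left_inv ξ := adjoint_adjoint hp ξ
  right_inv ξ := MulOpposite.unop_injective (adjoint_adjoint hp ξ.unop)
  map_mul' ξ η := MulOpposite.unop_injective <|
    adjoint_eq hp ((isAdjoint_adjoint hp ξ).mul (isAdjoint_adjoint hp η))
  map_add' ξ η := MulOpposite.unop_injective <|
    adjoint_eq hp ((isAdjoint_adjoint hp ξ).add (isAdjoint_adjoint hp η))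

theorem fixesBase_adjointEquiv : FixesBase k (MvPolynomial σ k) (adjointEquiv hp) := fun f =>
  congrArg MulOpposite.op (adjoint_eq hp (IsAdjoint.mulOp f))

end

end DiffOp

namespace DiffOp

open MvPolynomial Filter

/-! ### Automorphisms that fix the polynomial ring -/

variable {σ k : Type*} [Fintype σ]

/-- The divided powers of positive order below `p ^ e` kill the image of the divided power with
exponent `(p ^ e - 1, …, p ^ e - 1)`. -/
theorem hasse_mul_hasse_corner [CommRing k] {p : ℕ} (hp : p.Prime) [CharP k p] {e : ℕ}
    {α : σ →₀ ℕ} (h0 : α ≠ 0) (hα : α ≤ corner σ p e) :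
    hasse α * hasse (corner σ p e) = (0 : Module.End k (MvPolynomial σ k)) := by
  refine LinearMap.ext fun f => MvPolynomial.ext _ _ fun γ => ?_
  obtain ⟨i, hi⟩ := Finsupp.ne_iff.1 h0
  have hdvd : p ∣ multiChoose (γ + α) α *
      multiChoose (γ + α + corner σ p e) (corner σ p e) := by
    rw [multiChoose, multiChoose, ← Finset.prod_mul_distrib]
    refine dvd_trans ?_ (Finset.dvd_prod_of_mem _ (Finset.mem_univ i))
    -- The factor is `(γ + α + q - 1)! / (γ! α! (q - 1)!)`, a multiple of `(α + q - 1) choose α`.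
    have h1 := Nat.choose_mul (n := γ i + α i + (p ^ e - 1)) (k := α i + (p ^ e - 1))
      (s := p ^ e - 1) (Nat.le_add_left _ _)
    rw [Nat.add_sub_cancel, Nat.add_sub_cancel] at h1
    simp only [Finsupp.add_apply, corner_apply]
    rw [mul_comm, ← h1, ← Nat.choose_symm_add]
    exact (dvd_choose_add_pow_sub_one hp (Nat.pos_of_ne_zero hi)
      (lt_pow_of_le_corner hp hα i)).mul_left _
  rw [Module.End.mul_apply, coeff_hasse, coeff_hasse, ← mul_assoc, ← Nat.cast_mul,
    (CharP.cast_eq_zero_iff k p _).2 hdvd, zero_mul, LinearMap.zero_apply, coeff_zero]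

theorem hasse_ne_zero [CommRing k] [Nontrivial k] (α : σ →₀ ℕ) :
    hasse α ≠ (0 : Module.End k (MvPolynomial σ k)) := by
  intro h
  have := LinearMap.congr_fun h (monomial α 1)
  rw [hasse_monomial, multiChoose_self] at this
  simp at this

/-- The divided power operator as an element of the ring of differential operators. -/
noncomputable def hasseRing (k : Type*) [CommRing k] (α : σ →₀ ℕ) : ring k (MvPolynomial σ k) :=
  ⟨hasse α, hasse_mem_ring α⟩

variable [Field k] {p : ℕ}

/-- An automorphism of the ring of differential operators that fixes the polynomial ring fixes the
divided powers. -/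
theorem apply_hasseRing (hp : p.Prime) [CharP k p]
    (τ : ring k (MvPolynomial σ k) ≃+* ring k (MvPolynomial σ k))
    (hτ : ∀ f, τ (ofRing k _ f) = ofRing k _ f) (m : ℕ) :
    ∀ α : σ →₀ ℕ, Finsupp.degree α = m → τ (hasseRing k α) = hasseRing k α := by
  induction m with
  | zero =>
    intro α hα
    obtain rfl := (Finsupp.degree_eq_zero_iff α).1 hα
    have h : hasseRing k (0 : σ →₀ ℕ) = 1 := Subtype.ext hasse_zero
    rw [h, map_one]
  | succ m ih =>
    intro α hα
    have h0 : α ≠ 0 := by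
      rintro rfl
      simp at hα
    -- By induction `τ` fixes the commutators of `hasse α` with the variables.
    have hcomm : ∀ i, τ (hasseRing k α * ofRing k _ (X i) - ofRing k _ (X i) * hasseRing k α) =
        hasseRing k α * ofRing k _ (X i) - ofRing k _ (X i) * hasseRing k α := by
      intro i
      by_cases hi : α i = 0
      · have h : hasseRing k α * ofRing k _ (X i) - ofRing k _ (X i) * hasseRing k α = 0 :=
          Subtype.ext (hasse_commutator_of_eq_zero hi)
        rw [h, map_zero]
      · obtain ⟨α, rfl⟩ := exists_eq_add_single hi
        have h : hasseRing k (α + Finsupp.single i 1) * ofRing k _ (X i) -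
            ofRing k _ (X i) * hasseRing k (α + Finsupp.single i 1) = hasseRing k α :=
          Subtype.ext (hasse_add_single_commutator α i)
        rw [h]
        exact ih α (by simpa using hα)
    set δ : ring k (MvPolynomial σ k) := τ (hasseRing k α) - hasseRing k α
    have hX : ∀ i, (δ : Module.End k (MvPolynomial σ k)) * mulOp k _ (X i) =
        mulOp k _ (X i) * (δ : Module.End k (MvPolynomial σ k)) := by
      intro i
      have h := hcomm i
      rw [map_sub τ, map_mul, map_mul, hτ, ← sub_eq_zero] at h
      have h' : (τ (hasseRing k α)).1 * mulOp k _ (X i) - mulOp k _ (X i) * (τ (hasseRing k α)).1 -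
          (hasse α * mulOp k _ (X i) - mulOp k _ (X i) * hasse α) = 0 := congrArg Subtype.val h
      have e : (δ : Module.End k (MvPolynomial σ k)) = (τ (hasseRing k α)).1 - hasse α := rfl
      rw [← sub_eq_zero, ← h', e, sub_mul, mul_sub]
      abel
    have hδf := eq_mulOp_of_commute_X hX
    set f := (δ : Module.End k (MvPolynomial σ k)) 1
    -- A nonzero vector `w` that `τ (hasse α)` kills.
    obtain ⟨e, he⟩ := (eventually_le_corner hp α).exists
    have hne : τ (hasseRing k (corner σ p e)) ≠ 0 := fun h =>
      hasse_ne_zero (corner σ p e) (congrArg Subtype.val ((map_eq_zero_iff τ τ.injective).1 h))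
    obtain ⟨v, hv⟩ : ∃ v, (τ (hasseRing k (corner σ p e))).1 v ≠ 0 := by
      by_contra! h
      exact hne (Subtype.ext (LinearMap.ext h))
    have hprod : τ (hasseRing k α) * τ (hasseRing k (corner σ p e)) = 0 := by
      rw [← map_mul, show hasseRing k α * hasseRing k (corner σ p e) = 0 from
        Subtype.ext (hasse_mul_hasse_corner hp h0 he), map_zero]
    set w := (τ (hasseRing k (corner σ p e))).1 v
    have hw : (τ (hasseRing k α)).1 w = 0 :=
      LinearMap.congr_fun (congrArg Subtype.val hprod) v
    have hfw : f * w = -hasse α w := by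
      have h : (δ : Module.End k (MvPolynomial σ k)) w = (τ (hasseRing k α)).1 w - hasse α w := rfl
      rw [hw, zero_sub, hδf] at h
      exact h
    -- Multiplication by `f` cannot lower degrees, whereas `hasse α` does.
    have hf : f = 0 := by
      by_contra hf
      have hne : hasse α w ≠ 0 := neg_ne_zero.1 (hfw ▸ mul_ne_zero hf hv)
      have h1 := totalDegree_hasse_add_le hne
      rw [← totalDegree_neg, ← hfw, totalDegree_mul_of_isDomain hf hv] at h1
      omega
    have h0 : δ = 0 := Subtype.ext <| by
      rw [hδf, hf]
      exact map_zero (Algebra.lmul k _)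
    exact sub_eq_zero.1 h0

theorem eq_self_of_fixes (hp : p.Prime) [CharP k p]
    (τ : ring k (MvPolynomial σ k) ≃+* ring k (MvPolynomial σ k))
    (hτ : ∀ f, τ (ofRing k _ f) = ofRing k _ f) (ξ : ring k (MvPolynomial σ k)) : τ ξ = ξ := by
  obtain ⟨s, c, h⟩ := eq_hasse_sum ξ.2
  have h' : ξ = ∑ α ∈ s, ofRing k _ (c α) * hasseRing k α := Subtype.ext <| by
    rw [h, AddSubmonoidClass.coe_finsetSum]
    rfl
  rw [h', map_sum]
  exact Finset.sum_congr rfl fun α _ => by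
    rw [map_mul, hτ, apply_hasseRing hp τ hτ _ α rfl]

end DiffOp

theorem mainTheorem3 (p : ℕ) [Fact p.Prime] (k : Type*) [Field k] [CharP k p] [PerfectField k]
    (n : ℕ) :
    ∃! Φ : DiffOp.ring k (MvPolynomial (Fin n) k) ≃+*
        (DiffOp.ring k (MvPolynomial (Fin n) k))ᵐᵒᵖ,
      DiffOp.FixesBase k (MvPolynomial (Fin n) k) Φ := by
  have hp : p.Prime := Fact.out
  refine ⟨DiffOp.adjointEquiv hp, DiffOp.fixesBase_adjointEquiv hp, fun Ψ hΨ => ?_⟩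
  refine RingEquiv.ext fun ξ => ?_
  have h := DiffOp.eq_self_of_fixes hp (Ψ.trans (DiffOp.adjointEquiv hp).symm) (fun f => ?_) ξ
  · exact (RingEquiv.symm_apply_eq _).1 h
  · rw [RingEquiv.trans_apply, hΨ f]
    exact (RingEquiv.symm_apply_eq _).2 (DiffOp.fixesBase_adjointEquiv hp f).symm
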